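/- Theorem 2 (Lower bound on $F_{R_2}(r)$). Let $D,\lambda_1,\lambda_2>0$ and let $\Phi_1,\Phi_2$ be independent homogeneous Poisson point processes in $\mathbb{R}^2$ with densities $\lambda_1,\lambda_2$. Let $\mathcal{B}(y,s)$ be the disc of radius $s$ centered at $y$, let $o$ be the origin, and let $$\Psi=\Big\{x\in\Phi_2:\ x\notin\bigcup_{y\in\Phi_1}\mathcal{B}(y,D)\Big\}$$ be the Poisson hole process. Let $R_2$ be the distance from a typical hole center to the nearest point of $\Psi$, with distribution function $$F_{R_2}(r)=\mathbb{P}(R_2<r)=\mathbb{P}\big(\Psi\cap\mathcal{B}(o,r)\neq\emptyset\,\big|\,o\in\Phi_1\big),$$ where conditioning on $o\in\Phi_1$ means the Palm probability of $\Phi_1$: for every Borel set $A\subset\mathbb{R}^2$ of finite positive area, $$F_{R_2}(r)=\frac{\mathbb{E}\,\#\{y\in\Phi_1\cap A:\ \Psi\cap\mathcal{B}(y,r)\neq\emptyset\}}{\mathbb{E}\,\#(\Phi_1\cap A)}.$$ Then, for every $r>D$, $$F_{R_2}(r)\ \ge\ 1-\exp\!\big(-\lambda_2\pi(r^2-D^2)\big)\exp\!\big(-2\pi\lambda_1\mathcal{G}_4(r)\big),$$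 where $$\mathcal{G}_4(r)=\int_0^{r+D}\big(1-\exp(\lambda_2\mathcal{H}_2(r,r_y))\big)\,r_y\,dr_y,$$ $$\mathcal{H}_2(r,r_y)=\Big(\min\{r+D,\,r_y+2D\}^2-\max\{r_y,\,2D\}^2\Big)\,\arcsin\!\Big(\frac{D}{D+r_y}\Big).$$ -/

import Mathlib

open MeasureTheory ProbabilityTheory
open scoped NNReal ENNReal

namespace PHP

noncomputable section

/-- The Euclidean plane. -/
abbrev Plane : Type := EuclideanSpace ℝ (Fin 2)

/-- Locally finite subsets of the plane: the realisations of a (simple) point process. -/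
@[ext]
structure Config where
  /-- the set of points -/
  carrier : Set Plane
  /-- every bounded region holds finitely many points -/
  locallyFinite : ∀ B : Set Plane, Bornology.IsBounded B → (carrier ∩ B).Finite

/-- The number of points of a configuration in a region. -/
def Config.count (φ : Config) (B : Set Plane) : ℕ∞ := (φ.carrier ∩ B).encard

/-- The usual sigma-algebra on configurations, generated by the counts in Borel regions. -/
instance : MeasurableSpace Config :=
  ⨆ B : {B : Set Plane // MeasurableSet B},
    MeasurableSpace.comap (fun φ : Config => φ.count B.1) inferInstance

/-- The configuration seen from `y`, that is, translated by `-y`. -/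
def Config.seenFrom (y : Plane) (φ : Config) : Config where
  carrier := {x | x + y ∈ φ.carrier}
  locallyFinite := by
    intro B hB
    have hb : Bornology.IsBounded ((fun x : Plane => x + y) '' B) :=
      (LipschitzWith.isBounded_image (K := 1)
        (LipschitzWith.of_dist_le_mul (by intro a b; simp)) hB)
    refine Set.Finite.of_finite_image (f := fun x : Plane => x + y)
      ((φ.locallyFinite _ hb).subset ?_) (fun a _ b _ h => add_right_cancel h)
    rintro _ ⟨x, ⟨hx, hxB⟩, rfl⟩
    exact ⟨hx, x, hxB, rfl⟩

/-- `Φ` is a homogeneous Poisson point process in the plane with density `ℓ`: a random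
configuration whose number of points in each Borel region `B` of finite area is Poisson with mean
`ℓ * area B`, the numbers in finitely many disjoint regions being independent. -/
structure IsPoissonPointProcess {Ω : Type*} [MeasurableSpace Ω] (μ : Measure Ω) (ℓ : ℝ≥0)
    (Φ : Ω → Config) : Prop where
  measurable : Measurable Φ
  law_count : ∀ B : Set Plane, MeasurableSet B → volume B ≠ ∞ →
    HasLaw (fun ω => (Φ ω).count B)
      ((poissonMeasure (ℓ * (volume B).toNNReal)).map (fun n : ℕ => (n : ℕ∞))) μ
  indep_count : ∀ (n : ℕ) (B : Fin n → Set Plane), (∀ i, MeasurableSet (B i)) →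
    (∀ i j, i ≠ j → Disjoint (B i) (B j)) →
    iIndepFun (fun i ω => (Φ ω).count (B i)) μ

/-- The Poisson hole process: the points of `φ₂` outside all the holes of radius `D` around the
points of `φ₁`. -/
def holeProcess (D : ℝ) (φ₁ φ₂ : Config) : Set Plane :=
  {x | x ∈ φ₂.carrier ∧ x ∉ ⋃ y ∈ φ₁.carrier, Metric.ball y D}

/-- The contact distance from the origin: the distance from the origin to the nearest point of
`S` (infinite when `S` is empty). -/
def contactDistance (S : Set Plane) : ℝ≥0∞ := Metric.infEDist 0 S

/-- The contact distance is less than `r` exactly when the disc of radius `r` around the origin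
holds a point. -/
theorem contactDistance_lt_iff (S : Set Plane) (r : ℝ) :
    contactDistance S < ENNReal.ofReal r ↔ 0 < (S ∩ Metric.ball 0 r).encard := by
  rw [contactDistance, Metric.infEDist_lt_iff, Set.encard_pos]
  constructor
  · rintro ⟨y, hy, h⟩
    refine ⟨y, hy, ?_⟩
    rw [edist_dist, ENNReal.ofReal_lt_ofReal_iff_of_nonneg dist_nonneg] at h
    rwa [Metric.mem_ball, dist_comm]
  · rintro ⟨y, hy, h⟩
    refine ⟨y, hy, ?_⟩
    rw [edist_dist, ENNReal.ofReal_lt_ofReal_iff_of_nonneg dist_nonneg]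
    rwa [Metric.mem_ball, dist_comm] at h

/-- The Palm probability of the event `S` for the jointly stationary pair `(Φ₁, Φ₂)`, given that
the origin is a point of `Φ₁`, computed over the observation window `A`: the mean number of points
`y ∈ Φ₁ ∩ A` from which the pair looks like a pair in `S`, divided by the mean number of points in
`Φ₁ ∩ A`. -/
def palmProb {Ω : Type*} [MeasurableSpace Ω] (μ : Measure Ω) (Φ₁ Φ₂ : Ω → Config)
    (A : Set Plane) (S : Set (Config × Config)) : ℝ≥0∞ :=
  (∫⁻ ω, (({y | y ∈ (Φ₁ ω).carrier ∩ A ∧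
      ((Φ₁ ω).seenFrom y, (Φ₂ ω).seenFrom y) ∈ S}.encard : ℕ∞) : ℝ≥0∞) ∂μ) /
    ∫⁻ ω, (((Φ₁ ω).count A : ℕ∞) : ℝ≥0∞) ∂μ

/-- The distribution function `F_{R₂}(r) = ℙ(R₂ < r)` of the contact distance of the Poisson hole
process when the reference point is a typical hole center. -/
def contactCDF {Ω : Type*} [MeasurableSpace Ω] (μ : Measure Ω) (Φ₁ Φ₂ : Ω → Config)
    (D : ℝ) (A : Set Plane) (r : ℝ) : ℝ :=
  (palmProb μ Φ₁ Φ₂ A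
    {φ | contactDistance (holeProcess D φ.1 φ.2) < ENNReal.ofReal r}).toReal

/-- `θ(t) = arcsin (D / (D + t))`. -/
def theta (D t : ℝ) : ℝ := Real.arcsin (D / (D + t))

/-- The area `H₂(r, t)`. -/
def H₂ (D r t : ℝ) : ℝ :=
  (min (r + D) (t + 2 * D) ^ 2 - max t (2 * D) ^ 2) * theta D t

/-- `G₄(r)`, with `ℓ₂` the density of the baseline process. -/
def G₄ (ℓ₂ D r : ℝ) : ℝ :=
  ∫ t in (0 : ℝ)..(r + D), (1 - Real.exp (ℓ₂ * H₂ D r t)) * t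

end

end PHP

open MeasureTheory ProbabilityTheory
open scoped NNReal ENNReal

namespace PHP

/-! From a typical hole center, the contact distance is at least `r` only if every point of `Φ₂` in
the ring `D ≤ |x| < r` is swallowed by the hole of another point of `Φ₁`. Given the holes, `Φ₂`
misses the uncovered part of the ring with probability `exp (-ℓ₂ * area)`. That area is at least the
ring's area minus the sum of the separate overlaps `B(y, D) ∩ ring`, so the conditional probability
is at most `exp (-ℓ₂ π (r² - D²))` times a product of `exp (ℓ₂ |B(y, D) ∩ ring|)` over the other
centers. The mean of this product under the Palm law is the exponential of `ℓ₁ ∫ (exp (ℓ₂ |B(y, D) ∩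
ring|) - 1) dy`; bounding the overlap by `H₂` and passing to polar coordinates gives `exp (-2π ℓ₁
G₄)`.

Two points need work. The overlap bound (`volume_lens_le`) is no plain inclusion in a sector: it is
proved by bounding the arc at each radius (`arc_le`) and integrating (`chord_integral_le`).

The Palm mean is computed from counts alone, by discretization. The plane is tiled by cells of size
`δ`, each reference point is moved to the center of its cell, and holes are replaced by discs around
occupied cells. To keep the inequalities one-sided, the ring shrinks to the radii `D + 2δ`, `r - 2δ`
(`count_void_eq_zero`). Independence over disjoint cells then factorizes the mean
(`lintegral_count_mul_void_le`). Summing over cells gives the bound with perturbed radii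
(`one_sub_tailBound_le`), and `δ → 0` finishes. -/

/-! ### Area of a hole inside the ring. -/

theorem chord_le {D t ρ : ℝ} (hD : 0 < D) (ht : 0 < t) (hρ : D ≤ ρ) :
    (D ^ 2 - (ρ - t) ^ 2) * (D + t) ^ 2 ≤ 4 * ρ * t * D ^ 2 := by
  obtain ⟨u, rfl⟩ : ∃ u, ρ = D + u := ⟨ρ - D, by ring⟩
  have hu : 0 ≤ u := by linarith
  -- A quadratic in `u` with linear coefficient `-c`. For `c ≤ 0` every term is nonnegative;
  -- otherwise `t ≥ D` and the discriminant is nonpositive.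
  have key : 4 * (D + u) * t * D ^ 2 - (D ^ 2 - (D + u - t) ^ 2) * (D + t) ^ 2 =
      t * (t - D) ^ 2 * (t + 2 * D) - u * (2 * (D + t) ^ 2 * (t - D) - 4 * t * D ^ 2)
        + (D + t) ^ 2 * u ^ 2 := by ring
  set c := 2 * (D + t) ^ 2 * (t - D) - 4 * t * D ^ 2 with hc
  have h0 : 0 ≤ t * (t - D) ^ 2 * (t + 2 * D) := by positivity
  have h2 : 0 ≤ (D + t) ^ 2 * u ^ 2 := by positivity
  rcases le_or_gt c 0 with h | h
  · nlinarith [mul_nonneg hu (neg_nonneg.2 h)]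
  · have htD : D ≤ t := by
      by_contra! hlt
      have : 2 * (D + t) ^ 2 * (t - D) ≤ 0 :=
        mul_nonpos_of_nonneg_of_nonpos (by positivity) (by linarith)
      have : 0 < 4 * t * D ^ 2 := by positivity
      linarith
    have hdisc : c ^ 2 ≤ 4 * ((D + t) ^ 2 * (t * (t - D) ^ 2 * (t + 2 * D))) := by
      have e : 4 * ((D + t) ^ 2 * (t * (t - D) ^ 2 * (t + 2 * D))) - c ^ 2 =
          4 * D ^ 2 * (t * c + (t + D) ^ 3 * (t - D)) := by
        rw [hc]; ring
      have : 0 ≤ 4 * D ^ 2 * (t * c + (t + D) ^ 3 * (t - D)) := by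
        have := sub_nonneg.2 htD
        positivity
      linarith
    have hsq : 0 ≤ (D + t) ^ 2 * (t * (t - D) ^ 2 * (t + 2 * D) - u * c + (D + t) ^ 2 * u ^ 2) := by
      nlinarith [sq_nonneg (2 * (D + t) ^ 2 * u - c)]
    have := nonneg_of_mul_nonneg_right hsq (by positivity)
    linarith

/-- The quartic need not be monotone: for `t > D` it dips to a local minimum at `0`. For `t ≤ D` the
increment has nonnegative coefficients. For `t ≥ D` the left endpoint `-e` has a nonpositive value,
and for `y = -z < 0` the value is `z² g(z)` with `g` decreasing on `[0, e]`. -/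
theorem antideriv_le {D t x y : ℝ} (hD : 0 < D) (ht : 0 < t) (hx : x = max (-D) (D - t))
    (hxy : x ≤ y) (hy : y ≤ D) :
    6 * D ^ 2 * (t - D) * x ^ 2 + 4 * t * (t + D) * x ^ 3 + 3 * (t + D) * x ^ 4 ≤
    6 * D ^ 2 * (t - D) * y ^ 2 + 4 * t * (t + D) * y ^ 3 + 3 * (t + D) * y ^ 4 := by
  rcases le_total t D with htD | htD
  · have hx' : x = D - t := by rw [hx, max_eq_right]; linarith
    have hx0 : 0 ≤ x := by linarith
    obtain ⟨u, hu, rfl⟩ : ∃ u, 0 ≤ u ∧ y = x + u := ⟨y - x, by linarith, by ring⟩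
    obtain rfl : D = t + x := by linarith
    have : 6 * (t + x) ^ 2 * (t - (t + x)) * (x + u) ^ 2 + 4 * t * (t + (t + x)) * (x + u) ^ 3
        + 3 * (t + (t + x)) * (x + u) ^ 4 - (6 * (t + x) ^ 2 * (t - (t + x)) * x ^ 2
        + 4 * t * (t + (t + x)) * x ^ 3 + 3 * (t + (t + x)) * x ^ 4) =
        u * (12 * t ^ 2 * x ^ 2 + 12 * t * x ^ 3) +
        u ^ 2 * (18 * t ^ 2 * x + 36 * t * x ^ 2 + 12 * x ^ 3) +
        u ^ 3 * (8 * t ^ 2 + 28 * t * x + 12 * x ^ 2) + u ^ 4 * (6 * t + 3 * x) := by ring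
    have : 0 ≤ u * (12 * t ^ 2 * x ^ 2 + 12 * t * x ^ 3) +
        u ^ 2 * (18 * t ^ 2 * x + 36 * t * x ^ 2 + 12 * x ^ 3) +
        u ^ 3 * (8 * t ^ 2 + 28 * t * x + 12 * x ^ 2) + u ^ 4 * (6 * t + 3 * x) := by positivity
    linarith
  · obtain ⟨e, he⟩ : ∃ e, e = -x := ⟨_, rfl⟩
    obtain rfl : x = -e := by linarith
    have htD' := sub_nonneg.2 htD
    have heD : e ≤ D := by linarith [le_max_left (-D) (D - t)]
    have het : e ≤ t - D := by linarith [le_max_right (-D) (D - t)]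
    have he0 : 0 ≤ e := by
      have : -e ≤ 0 := by rw [hx]; exact max_le (by linarith) (by linarith)
      linarith
    have hneg : 6 * D ^ 2 * (t - D) - 4 * t * (t + D) * e + 3 * (t + D) * e ^ 2 ≤ 0 := by
      rcases max_choice (-D) (D - t) with h | h
      · obtain rfl : e = D := by linarith
        have : e ≤ t - e := het
        nlinarith [mul_nonneg he0 (sub_nonneg.2 this),
          mul_nonneg he0 (mul_nonneg ht.le (sub_nonneg.2 this)),
          mul_nonneg he0 (mul_nonneg he0 ht.le), pow_nonneg he0 3]
      · obtain rfl : e = t - D := by linarith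
        have : 6 * D ^ 2 * (t - D) - 4 * t * (t + D) * (t - D) + 3 * (t + D) * (t - D) ^ 2 =
          - ((t - D) * ((t - D) * (t + 5 * D) + 2 * D ^ 2)) := by ring
        have : 0 ≤ (t - D) * ((t - D) * (t + 5 * D) + 2 * D ^ 2) := by positivity
        linarith
    have h1 : 6 * D ^ 2 * (t - D) * (-e) ^ 2 + 4 * t * (t + D) * (-e) ^ 3
        + 3 * (t + D) * (-e) ^ 4 =
        e ^ 2 * (6 * D ^ 2 * (t - D) - 4 * t * (t + D) * e + 3 * (t + D) * e ^ 2) := by ring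
    have h1' : e ^ 2 * (6 * D ^ 2 * (t - D) - 4 * t * (t + D) * e + 3 * (t + D) * e ^ 2) ≤ 0 :=
      mul_nonpos_of_nonneg_of_nonpos (by positivity) hneg
    rw [h1]
    rcases le_total 0 y with hy0 | hy0
    · exact h1'.trans (by positivity)
    · obtain ⟨z, rfl⟩ : ∃ z, y = -z := ⟨-y, by ring⟩
      have hz0 : 0 ≤ z := by linarith
      have hze : z ≤ e := by linarith
      have h2 : 6 * D ^ 2 * (t - D) * (-z) ^ 2 + 4 * t * (t + D) * (-z) ^ 3
        + 3 * (t + D) * (-z) ^ 4 =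
        z ^ 2 * (6 * D ^ 2 * (t - D) - 4 * t * (t + D) * z + 3 * (t + D) * z ^ 2) := by ring
      rw [h2]
      set g := 6 * D ^ 2 * (t - D) - 4 * t * (t + D) * z + 3 * (t + D) * z ^ 2 with hg
      rcases le_total 0 g with hg0 | hg0
      · exact h1'.trans (by positivity)
      · have h3 : 6 * D ^ 2 * (t - D) - 4 * t * (t + D) * e + 3 * (t + D) * e ^ 2 ≤ g := by
          have : g - (6 * D ^ 2 * (t - D) - 4 * t * (t + D) * e + 3 * (t + D) * e ^ 2) =
            (t + D) * (e - z) * (4 * t - 3 * (e + z)) := by rw [hg]; ring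
          have h5 : 0 ≤ 4 * t - 3 * (e + z) := by linarith
          have := mul_nonneg (mul_nonneg (by linarith : 0 ≤ t + D) (sub_nonneg.2 hze)) h5
          linarith
        have h4 : z ^ 2 ≤ e ^ 2 := by gcongr
        calc _ ≤ e ^ 2 * g := by gcongr
          _ ≤ z ^ 2 * g := mul_le_mul_of_nonpos_right h4 hg0

/-- With `w = D² - (ρ - t)²`, membership in the disc reads `4ρt sin²(α/2) < w`. Two bounds on `w`
are combined: `chord_le` gives `sin(|α|/2) ≤ sin θ`, and AM-GM applied to `D` and `ρw/(tD)`, whose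
sum is the bracket in the statement, gives a bound rational in `ρ`. Concavity of sine turns these
into a bound on the angle. -/
theorem arc_le {D t ρ α : ℝ} (hD : 0 < D) (ht : 0 < t) (hρ : D ≤ ρ) (hα : |α| ≤ Real.pi)
    (h : ρ ^ 2 + t ^ 2 - 2 * ρ * t * Real.cos α < D ^ 2) :
    |α| ≤ theta D t * (D + t) / D * (D + ρ * (D ^ 2 - (ρ - t) ^ 2) / (t * D)) / (2 * ρ) := by
  have hρ0 : 0 < ρ := by linarith
  set σ := D / (D + t) with hσ
  have hσ0 : 0 < σ := by positivity
  have hσ1 : σ ≤ 1 := by rw [hσ, div_le_one (by positivity)]; linarith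
  set θ := theta D t with hθ
  have hθs : Real.sin θ = σ := Real.sin_arcsin (by linarith) hσ1
  have hθ0 : 0 < θ := Real.arcsin_pos.2 hσ0
  have hθ2 : θ ≤ Real.pi / 2 := Real.arcsin_le_pi_div_two _
  set Q := D + ρ * (D ^ 2 - (ρ - t) ^ 2) / (t * D) with hQ
  have hcos : Real.cos α = 1 - 2 * Real.sin (|α| / 2) ^ 2 := by
    have := Real.cos_sq (|α| / 2)
    rw [mul_div_cancel₀ _ (two_ne_zero), Real.cos_abs, Real.cos_sq'] at this
    linarith
  have hs : 4 * ρ * t * Real.sin (|α| / 2) ^ 2 < D ^ 2 - (ρ - t) ^ 2 := by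
    rw [hcos] at h; nlinarith
  have hpos : 0 < D ^ 2 - (ρ - t) ^ 2 := lt_of_le_of_lt (by positivity) hs
  have hQ0 : 0 < Q := by positivity
  set l := Q / (4 * ρ * σ) with hl
  have hl0 : 0 < l := by positivity
  have hgoal : θ * (D + t) / D * Q / (2 * ρ) = 2 * (l * θ) := by
    rw [hl, hσ]; field_simp; ring
  rw [hgoal]
  by_contra! hcon
  -- Capping at `1` keeps `l' * θ` in `[0, θ]`, where concavity gives `sin (l' θ) ≥ l' sin θ`. The
  -- two values of the minimum call for the two bounds on `w`.
  set l' := min l 1 with hl'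
  have hl'0 : 0 < l' := lt_min hl0 one_pos
  have h1 : l' * θ ≤ |α| / 2 := by
    have : l' * θ ≤ l * θ := mul_le_mul_of_nonneg_right (min_le_left _ _) hθ0.le
    linarith
  have h2 : l' * σ ≤ Real.sin (l' * θ) := by
    have := strictConcaveOn_sin_Icc.concaveOn.2 (⟨le_rfl, Real.pi_pos.le⟩ : (0 : ℝ) ∈ Set.Icc 0 Real.pi)
      (⟨hθ0.le, by linarith [Real.pi_pos]⟩ : θ ∈ Set.Icc 0 Real.pi)
      (by linarith [min_le_right l 1] : 0 ≤ 1 - l') hl'0.le (by ring)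
    simpa [hθs] using this
  have h3 : Real.sin (l' * θ) ≤ Real.sin (|α| / 2) := by
    apply Real.sin_le_sin_of_le_of_le_pi_div_two _ (by linarith) h1
    have : 0 ≤ l' * θ := by positivity
    linarith [Real.pi_pos]
  have h4 : (l' * σ) ^ 2 ≤ Real.sin (|α| / 2) ^ 2 :=
    pow_le_pow_left₀ (by positivity) (h2.trans h3) 2
  have h5 : D ^ 2 - (ρ - t) ^ 2 ≤ 4 * ρ * t * (l' * σ) ^ 2 := by
    rcases min_choice l 1 with h | h
    · have e : l' * σ = Q / (4 * ρ) := by rw [hl', h, hl]; field_simp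
      rw [e]
      have e2 : 4 * ρ * t * (Q / (4 * ρ)) ^ 2 = t * Q ^ 2 / (4 * ρ) := by field_simp
      rw [e2, le_div_iff₀ (by positivity)]
      set w := D ^ 2 - (ρ - t) ^ 2
      have e3 : t * Q ^ 2 - w * (4 * ρ) = t * (D - ρ * w / (t * D)) ^ 2 := by
        rw [hQ]; field_simp; ring
      have : 0 ≤ t * (D - ρ * w / (t * D)) ^ 2 := by positivity
      linarith
    · rw [hl', h, one_mul, hσ, div_pow, ← mul_div_assoc, le_div_iff₀ (by positivity)]
      exact chord_le hD ht hρ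
  have : 4 * ρ * t * (l' * σ) ^ 2 ≤ 4 * ρ * t * Real.sin (|α| / 2) ^ 2 := by gcongr
  linarith

/-- The minimum and maximum on the right are the integration endpoints shifted by `D`. Multiplied by
`12 D t (t + D)`, the difference of the two sides is the increment of the quartic of `antideriv_le`
between the endpoints shifted by `-t`. -/
theorem chord_integral_le {D r t : ℝ} (hD : 0 < D) (ht : 0 < t)
    (hab : max D (t - D) ≤ min r (t + D)) :
    ∫ ρ in max D (t - D)..min r (t + D), (D + ρ * (D ^ 2 - (ρ - t) ^ 2) / (t * D)) ≤
      D / (D + t) * (min (r + D) (t + 2 * D) ^ 2 - max t (2 * D) ^ 2) := by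
  have hb : min (r + D) (t + 2 * D) = min r (t + D) + D := by
    rw [← min_add_add_right]; ring_nf
  have ha : max t (2 * D) = max D (t - D) + D := by
    rw [← max_add_add_right, max_comm]; ring_nf
  have hx : max D (t - D) - t = max (-D) (D - t) := by
    rw [← max_sub_sub_right, max_comm]; ring_nf
  rw [hb, ha]
  set a := max D (t - D)
  set b := min r (t + D) with hb
  have hderiv : ∀ ρ ∈ Set.uIcc a b, HasDerivAt (fun ρ => D * ρ + (D ^ 2 * ρ ^ 2 / 2 -
      (ρ ^ 4 / 4 - 2 * t * ρ ^ 3 / 3 + t ^ 2 * ρ ^ 2 / 2)) / (t * D))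
      (D + ρ * (D ^ 2 - (ρ - t) ^ 2) / (t * D)) ρ := by
    intro ρ _
    have h := (((hasDerivAt_id ρ).const_mul D).add ((((((hasDerivAt_id ρ).pow 2).const_mul
      (D ^ 2)).div_const 2).sub ((((((hasDerivAt_id ρ).pow 4).div_const 4).sub
      ((((hasDerivAt_id ρ).pow 3).const_mul (2 * t)).div_const 3))).add
      ((((hasDerivAt_id ρ).pow 2).const_mul (t ^ 2)).div_const 2))).div_const (t * D)))
    refine h.congr_deriv ?_
    simp only [id]
    push_cast
    ring
  rw [intervalIntegral.integral_eq_sub_of_hasDerivAt hderiv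
    (Continuous.intervalIntegrable (by fun_prop) _ _)]
  have hV := antideriv_le hD ht hx (sub_le_sub_right hab t) (by linarith [min_le_right r (t + D)])
  rw [← sub_nonneg] at hV ⊢
  have hpos : 0 < 12 * D * t * (t + D) := by positivity
  refine le_of_mul_le_mul_left ?_ hpos
  rw [mul_zero]
  refine hV.trans_eq ?_
  field_simp
  ring

theorem volume_lens_complex_le {D r t : ℝ} (hD : 0 < D) (ht : 0 < t) (htr : t < r + D) (hr : D < r) :
    volume {z : ℂ | D ≤ ‖z‖ ∧ ‖z‖ < r ∧ ‖z - t‖ < D} ≤ ENNReal.ofReal (H₂ D r t) := by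
  set S := {z : ℂ | D ≤ ‖z‖ ∧ ‖z‖ < r ∧ ‖z - t‖ < D} with hS
  have hSm : MeasurableSet S := by
    refine MeasurableSet.inter ?_ (MeasurableSet.inter ?_ ?_)
    · exact measurableSet_le measurable_const measurable_norm
    · exact measurableSet_lt measurable_norm measurable_const
    · exact measurableSet_lt (f := fun z : ℂ => ‖z - t‖) (by fun_prop) measurable_const
  set a := max D (t - D) with ha
  set b := min r (t + D) with hb
  have hab : a ≤ b := max_le (le_min hr.le (by linarith)) (le_min (by linarith) (by linarith))
  set Q : ℝ → ℝ := fun ρ => D + ρ * (D ^ 2 - (ρ - t) ^ 2) / (t * D) with hQ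
  set κ := theta D t * (D + t) / D with hκ
  have hθ0 : 0 ≤ theta D t := Real.arcsin_nonneg.2 (by positivity)
  have hκ0 : 0 ≤ κ := by positivity
  set m : ℝ → ℝ := fun ρ => κ * Q ρ / (2 * ρ) with hm
  have hmm : Measurable m := by
    have : Measurable Q := by fun_prop
    fun_prop
  have hQ0 : ∀ ρ ∈ Set.Icc a b, 0 ≤ Q ρ := by
    intro ρ ⟨h1, h2⟩
    have h3 : 0 ≤ D ^ 2 - (ρ - t) ^ 2 := by
      have h4 : |ρ - t| ≤ D := by
        rw [abs_le]
        constructor <;> linarith [le_max_right D (t - D), min_le_right r (t + D)]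
      nlinarith [sq_abs (ρ - t), abs_nonneg (ρ - t)]
    have : 0 < ρ := by linarith [le_max_left D (t - D)]
    positivity
  rw [← lintegral_indicator_one hSm, ← Complex.lintegral_comp_polarCoord_symm]
  calc
    _ ≤ ∫⁻ p in polarCoord.target, (Set.Icc a b).indicator (fun ρ => ENNReal.ofReal ρ) p.1 *
        {p : ℝ × ℝ | |p.2| ≤ m p.1}.indicator 1 p := by
      refine setLIntegral_mono' polarCoord.open_target.measurableSet ?_
      rintro ⟨ρ, α⟩ ⟨hρ, hα⟩
      simp only [Set.mem_Ioi, Set.mem_Ioo] at hρ hα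
      by_cases hmem : Complex.polarCoord.symm (ρ, α) ∈ S
      · have hn : ‖Complex.polarCoord.symm (ρ, α)‖ = ρ := by
          rw [Complex.norm_polarCoord_symm, abs_of_pos hρ]
        obtain ⟨h1, h2, h3⟩ := id hmem
        rw [hn] at h1 h2
        have h4 : |ρ - t| < D := by
          refine lt_of_le_of_lt ?_ h3
          have := abs_norm_sub_norm_le (Complex.polarCoord.symm (ρ, α)) (t : ℂ)
          rwa [hn, Complex.norm_real, Real.norm_of_nonneg ht.le] at this
        rw [abs_lt] at h4
        have h5 : ρ ∈ Set.Icc a b := ⟨max_le h1 (by linarith), le_min h2.le (by linarith)⟩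
        have h6 : |α| ≤ m ρ := by
          refine arc_le hD ht h1 (abs_le.2 ⟨hα.1.le, hα.2.le⟩) ?_
          have : ‖Complex.polarCoord.symm (ρ, α) - t‖ ^ 2 < D ^ 2 := by
            gcongr
          rw [← Complex.normSq_eq_norm_sq, Complex.polarCoord_symm_apply, Complex.normSq_apply] at this
          simp at this
          rw [← Complex.ofReal_cos, ← Complex.ofReal_sin] at this
          simp only [Complex.ofReal_re] at this
          nlinarith [Real.sin_sq_add_cos_sq α]
        have h7 : ((ρ, α) : ℝ × ℝ) ∈ {p : ℝ × ℝ | |p.2| ≤ m p.1} := h6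
        rw [Set.indicator_of_mem h5, Set.indicator_of_mem h7, Set.indicator_of_mem hmem]
        simp
      · rw [Set.indicator_of_notMem hmem]; simp
    -- `m ρ` may exceed `π`; dropping the restriction on the angle only enlarges the integral and
    -- makes each arc an interval of length `2 * m ρ`.
    _ ≤ ∫⁻ p : ℝ × ℝ, (Set.Icc a b).indicator (fun ρ => ENNReal.ofReal ρ) p.1 *
        {p : ℝ × ℝ | |p.2| ≤ m p.1}.indicator 1 p := setLIntegral_le_lintegral _ _
    _ = ∫⁻ ρ, ∫⁻ α, (Set.Icc a b).indicator (fun ρ => ENNReal.ofReal ρ) ρ *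
        {p : ℝ × ℝ | |p.2| ≤ m p.1}.indicator 1 (ρ, α) := by
      have h1 : MeasurableSet {p : ℝ × ℝ | |p.2| ≤ m p.1} :=
        measurableSet_le (by fun_prop) (by fun_prop)
      rw [Measure.volume_eq_prod, lintegral_prod]
      refine Measurable.aemeasurable (Measurable.mul ?_ ?_)
      · exact (Measurable.indicator (by fun_prop) measurableSet_Icc).comp measurable_fst
      · exact measurable_one.indicator h1
    _ ≤ ∫⁻ ρ in Set.Icc a b, ENNReal.ofReal (κ * Q ρ) := by
      rw [← lintegral_indicator measurableSet_Icc]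
      refine lintegral_mono fun ρ => ?_
      by_cases hρ : ρ ∈ Set.Icc a b
      · simp only [Set.indicator_of_mem hρ]
        have hρ0 : 0 < ρ := by linarith [le_max_left D (t - D), hρ.1]
        have e : (fun α => ENNReal.ofReal ρ * {p : ℝ × ℝ | |p.2| ≤ m p.1}.indicator
            (1 : ℝ × ℝ → ℝ≥0∞) (ρ, α)) =
            fun α => ENNReal.ofReal ρ * (Set.Icc (-m ρ) (m ρ)).indicator 1 α := by
          ext α
          congr 1
          by_cases h : |α| ≤ m ρ
          · rw [Set.indicator_of_mem (by exact h), Set.indicator_of_mem (by exact abs_le.1 h)]; rfl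
          · rw [Set.indicator_of_notMem (by exact h),
              Set.indicator_of_notMem (by exact fun h' => h (abs_le.2 h'))]
        rw [e, lintegral_const_mul _ (measurable_one.indicator measurableSet_Icc),
          lintegral_indicator_one measurableSet_Icc, Real.volume_Icc,
          ← ENNReal.ofReal_mul hρ0.le]
        apply le_of_eq
        congr 1
        simp only [hm]
        field_simp
        ring
      · simp [Set.indicator_of_notMem hρ]
    _ = ENNReal.ofReal (κ * ∫ ρ in a..b, Q ρ) := by
      rw [intervalIntegral.integral_of_le hab, ← integral_Icc_eq_integral_Ioc,
        ← integral_const_mul, ofReal_integral_eq_lintegral_ofReal]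
      · exact Continuous.integrableOn_Icc (by fun_prop)
      · refine (ae_restrict_iff' measurableSet_Icc).2 (.of_forall fun ρ hρ => ?_)
        exact mul_nonneg hκ0 (hQ0 ρ hρ)
    _ ≤ ENNReal.ofReal (H₂ D r t) := by
      apply ENNReal.ofReal_le_ofReal
      calc _ ≤ κ * (D / (D + t) * (min (r + D) (t + 2 * D) ^ 2 - max t (2 * D) ^ 2)) := by
            gcongr; exact chord_integral_le hD ht hab
        _ = H₂ D r t := by
          rw [hκ, H₂]; field_simp

theorem exists_complex_isometry (y : Plane) : ∃ e : ℂ ≃ₗᵢ[ℝ] Plane, e (‖y‖ : ℂ) = y := by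
  let e₀ : ℂ ≃ₗᵢ[ℝ] Plane := Complex.orthonormalBasisOneI.repr
  have h : ‖e₀ (‖y‖ : ℂ)‖ = ‖y‖ := by
    rw [e₀.norm_map, Complex.norm_real, norm_norm]
  -- Reflection in the orthogonal complement of the difference of two vectors of equal norm swaps
  -- them.
  exact ⟨e₀.trans (Submodule.reflection (ℝ ∙ (e₀ (‖y‖ : ℂ) - y))ᗮ), Submodule.reflection_sub h⟩

theorem volume_lens_le {D r : ℝ} (hD : 0 < D) (hr : D < r) (y : Plane) :
    volume (Metric.ball y D ∩ (Metric.ball 0 r \ Metric.ball 0 D)) ≤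
      if ‖y‖ < r + D then ENNReal.ofReal (H₂ D r ‖y‖) else 0 := by
  split_ifs with h
  · rcases (norm_nonneg y).eq_or_lt with h0 | h0
    · have : y = 0 := norm_eq_zero.1 h0.symm
      subst this
      have : Metric.ball (0 : Plane) D ∩ (Metric.ball 0 r \ Metric.ball 0 D) = ∅ := by
        ext z; simp
      simp [this]
    · obtain ⟨e, he⟩ := exists_complex_isometry y
      have hmp := e.measurePreserving
      rw [← hmp.measure_preimage ((measurableSet_ball.inter
        (measurableSet_ball.diff measurableSet_ball)).nullMeasurableSet)]
      refine (measure_mono ?_).trans (volume_lens_complex_le hD h0 h hr)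
      intro z hz
      simp only [Set.mem_preimage, Set.mem_inter_iff, Set.mem_sdiff, Metric.mem_ball, dist_zero_right,
        LinearIsometryEquiv.norm_map, not_lt] at hz
      refine ⟨hz.2.2, hz.2.1, ?_⟩
      have := hz.1
      nth_rw 1 [← he] at this
      rwa [e.dist_map, dist_eq_norm] at this
  · have : Metric.ball y D ∩ (Metric.ball 0 r \ Metric.ball 0 D) = ∅ := by
      rw [Set.eq_empty_iff_forall_notMem]
      rintro z ⟨h1, h2, -⟩
      rw [Metric.mem_ball, dist_comm, dist_eq_norm] at h1
      rw [Metric.mem_ball, dist_zero_right] at h2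
      have := norm_sub_norm_le y z
      linarith
    simp [this]

/-! ### Bounds, limits and radial integrals for `H₂` and `G₄`. -/

theorem measurable_H₂ (D r : ℝ) : Measurable (H₂ D r) := by
  unfold H₂ theta
  have := Real.measurable_arcsin
  fun_prop

theorem H₂_nonneg {D r t : ℝ} (hD : 0 < D) (hr : D < r) (ht : 0 ≤ t) (htr : t ≤ r + D) :
    0 ≤ H₂ D r t := by
  have hθ0 : 0 ≤ theta D t := Real.arcsin_nonneg.2 (by positivity)
  have h : max t (2 * D) ≤ min (r + D) (t + 2 * D) :=
    max_le (le_min htr (by linarith)) (le_min (by linarith) (by linarith))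
  have h0 : 0 ≤ max t (2 * D) := le_max_of_le_left ht
  have := pow_le_pow_left₀ h0 h 2
  exact mul_nonneg (by linarith) hθ0

theorem H₂_le {D r t : ℝ} (hD : 0 < D) (hr : D < r) (ht : 0 ≤ t) :
    H₂ D r t ≤ (r + D) ^ 2 * (Real.pi / 2) := by
  have hθ0 : 0 ≤ theta D t := Real.arcsin_nonneg.2 (by positivity)
  have hθ2 : theta D t ≤ Real.pi / 2 := Real.arcsin_le_pi_div_two _
  have h1 : min (r + D) (t + 2 * D) ^ 2 ≤ (r + D) ^ 2 :=
    pow_le_pow_left₀ (le_min (by linarith) (by linarith)) (min_le_left _ _) 2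
  have h2 : 0 ≤ max t (2 * D) ^ 2 := by positivity
  calc H₂ D r t ≤ (r + D) ^ 2 * theta D t := by
        unfold H₂; gcongr; linarith
    _ ≤ _ := by gcongr

/-- The perturbations cancel in the upper endpoint `(r - η) + (D + η)`, so dominated convergence
applies on a fixed interval. -/
theorem tendsto_G₄ (l : ℝ≥0) {D r : ℝ} (hD : 0 < D) (hr : D < r) :
    Filter.Tendsto (fun η => G₄ l (D + η) (r - η)) (nhdsWithin 0 (Set.Ioi 0)) (nhds (G₄ l D r)) := by
  have e : ∀ η, G₄ l (D + η) (r - η) =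
      ∫ t in (0 : ℝ)..(r + D), (1 - Real.exp (l * H₂ (D + η) (r - η) t)) * t := by
    intro η
    rw [G₄]
    congr 1
    ring
  simp_rw [e]
  have hev : ∀ᶠ η in nhdsWithin (0 : ℝ) (Set.Ioi 0), 0 < η ∧ D + η < r - η := by
    have : ∀ᶠ η in nhds (0 : ℝ), D + η < r - η :=
      (by fun_prop : Continuous fun η : ℝ => D + η).continuousAt.eventually_lt
        (by fun_prop : Continuous fun η : ℝ => r - η).continuousAt (by simpa using hr)
    filter_upwards [self_mem_nhdsWithin, this.filter_mono nhdsWithin_le_nhds] with η h1 h2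
    exact ⟨h1, h2⟩
  refine intervalIntegral.tendsto_integral_filter_of_dominated_convergence
    (fun _ => (Real.exp (l * ((r + D) ^ 2 * (Real.pi / 2)))) * (r + D)) ?_ ?_ ?_ ?_
  · refine .of_forall fun η => Measurable.aestronglyMeasurable ?_
    have := measurable_H₂ (D + η) (r - η)
    fun_prop
  · filter_upwards [hev] with η ⟨h0, h1⟩
    refine .of_forall fun t ht => ?_
    rw [Set.uIoc_of_le (by linarith)] at ht
    rw [norm_mul, Real.norm_of_nonneg ht.1.le]
    have hH0 := H₂_nonneg (by linarith : 0 < D + η) h1 ht.1.le (by linarith [ht.2])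
    have hH1 := H₂_le (by linarith : 0 < D + η) h1 ht.1.le
    have e : r - η + (D + η) = r + D := by ring
    rw [e] at hH1
    have h2 : (0 : ℝ) ≤ l * H₂ (D + η) (r - η) t := by positivity
    have h3 := Real.one_le_exp h2
    have h4 : Real.exp (l * H₂ (D + η) (r - η) t) ≤ Real.exp (l * ((r + D) ^ 2 * (Real.pi / 2))) := by
      gcongr
    have h5 : ‖1 - Real.exp (l * H₂ (D + η) (r - η) t)‖ ≤
        Real.exp (l * ((r + D) ^ 2 * (Real.pi / 2))) := by
      rw [Real.norm_of_nonpos (by linarith)]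
      linarith
    have := ht.1.le
    gcongr
    exact ht.2
  · exact intervalIntegrable_const
  · refine .of_forall fun t ht => ?_
    rw [Set.uIoc_of_le (by linarith)] at ht
    refine Filter.Tendsto.mono_left ?_ nhdsWithin_le_nhds
    have hc : ContinuousAt (fun η : ℝ => (1 - Real.exp (l * H₂ (D + η) (r - η) t)) * t) 0 := by
      unfold H₂ theta
      have : D + 0 + t ≠ 0 := by linarith [ht.1]
      have h1 : ContinuousAt (fun η : ℝ => Real.arcsin ((D + η) / (D + η + t))) 0 := by
        refine Real.continuous_arcsin.continuousAt.comp ?_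
        exact ContinuousAt.div (by fun_prop) (by fun_prop) this
      fun_prop
    have := hc.tendsto
    simpa using this

/-- The excess `exp (ℓ₂ H₂) - 1` as a radial density on the plane. -/
noncomputable def excess (l : ℝ≥0) (D r : ℝ) (y : Plane) : ℝ≥0∞ :=
  ENNReal.ofReal ((Set.Iio (r + D)).indicator (fun t => Real.exp (l * H₂ D r t) - 1) ‖y‖)

theorem lintegral_excess (l : ℝ≥0) {D r : ℝ} (hD : 0 < D) (hr : D < r) :
    ∫⁻ y, excess l D r y = ENNReal.ofReal (-(2 * Real.pi * G₄ l D r)) := by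
  have hH := measurable_H₂ D r
  set f : ℝ → ℝ := (Set.Iio (r + D)).indicator (fun t => Real.exp (l * H₂ D r t) - 1) with hf
  have hfm : Measurable f := Measurable.indicator (by fun_prop) measurableSet_Iio
  have hf0 : ∀ t, 0 ≤ t → 0 ≤ f t := by
    intro t ht
    rw [hf, Set.indicator_apply]
    split_ifs with h
    swap
    · exact le_rfl
    have := H₂_nonneg hD hr ht (le_of_lt h)
    have : (0 : ℝ) ≤ l * H₂ D r t := by positivity
    linarith [Real.one_le_exp this]
  have hint : Integrable (fun y : Plane => f ‖y‖) := by
    have hball : IntegrableOn (fun _ : Plane => Real.exp (l * ((r + D) ^ 2 * (Real.pi / 2))))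
        (Metric.ball 0 (r + D)) := integrableOn_const (measure_ball_lt_top.ne)
    rw [← integrable_indicator_iff measurableSet_ball] at hball
    refine hball.mono' (hfm.comp measurable_norm).aestronglyMeasurable (.of_forall fun y => ?_)
    rw [Real.norm_of_nonneg (hf0 _ (norm_nonneg _))]
    by_cases h : ‖y‖ < r + D
    · rw [Set.indicator_of_mem (by simpa using h), hf, Set.indicator_of_mem (Set.mem_Iio.2 h)]
      have := H₂_le hD hr (norm_nonneg y)
      have : Real.exp (l * H₂ D r ‖y‖) ≤ Real.exp (l * ((r + D) ^ 2 * (Real.pi / 2))) := by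
        gcongr
      linarith
    · rw [hf, Set.indicator_of_notMem (by exact h)]
      exact Set.indicator_nonneg (fun _ _ => (Real.exp_pos _).le) _
  unfold excess
  rw [← ofReal_integral_eq_lintegral_ofReal hint (.of_forall fun y => hf0 _ (norm_nonneg _)),
    integral_fun_norm_addHaar]
  congr 1
  have hv : (volume : Measure Plane).real (Metric.ball 0 1) = Real.pi := by
    simp [measureReal_def, EuclideanSpace.volume_ball_fin_two, Real.pi_nonneg]
  have hfs : ∀ t : ℝ, t ^ (Module.finrank ℝ Plane - 1) • f t =
      (Set.Iio (r + D)).indicator (fun t => -((1 - Real.exp (l * H₂ D r t)) * t)) t := by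
    intro t
    rw [finrank_euclideanSpace, Fintype.card_fin, hf, Set.indicator_apply, Set.indicator_apply]
    split_ifs
    · rw [smul_eq_mul]; ring
    · simp
  simp_rw [hfs]
  rw [hv, finrank_euclideanSpace, Fintype.card_fin, G₄,
    intervalIntegral.integral_of_le (by linarith), integral_Ioc_eq_integral_Ioo,
    setIntegral_indicator measurableSet_Iio, Set.Ioi_inter_Iio, integral_neg]
  simp
  ring

/-! ### Means, void probabilities and independence of Poisson counts. -/

theorem measurable_count {B : Set Plane} (hB : MeasurableSet B) :
    Measurable fun φ : Config => φ.count B := by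
  refine Measurable.of_comap_le ?_
  exact le_iSup (fun B : {B : Set Plane // MeasurableSet B} =>
    MeasurableSpace.comap (fun φ : Config => φ.count B.1) inferInstance) ⟨B, hB⟩

theorem lintegral_poissonMeasure_id (l : ℝ≥0) : ∫⁻ n : ℕ, (n : ℝ≥0∞) ∂poissonMeasure l = l := by
  rw [poissonMeasure, lintegral_sum_measure]
  simp_rw [lintegral_smul_measure, lintegral_dirac, smul_eq_mul]
  have hs := (hasSum_one_poissonMeasure l).mul_left (l : ℝ)
  -- The term at `0` vanishes, and shifting the index turns the rest into `l` times the total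
  -- Poisson mass.
  rw [tsum_eq_zero_add' ENNReal.summable]
  have h : ∀ n : ℕ, ENNReal.ofReal (Real.exp (-l) * l ^ (n + 1) / (n + 1).factorial) *
      ((n + 1 : ℕ) : ℝ≥0∞) = ENNReal.ofReal (l * (Real.exp (-l) * l ^ n / n.factorial)) := by
    intro n
    rw [← ENNReal.ofReal_natCast, ← ENNReal.ofReal_mul (by positivity), Nat.factorial_succ]
    congr 1
    push_cast
    field_simp
    ring
  simp_rw [h]
  rw [← ENNReal.ofReal_tsum_of_nonneg (fun n => by positivity) hs.summable, hs.tsum_eq]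
  simp

section Poisson

variable {Ω : Type*} [MeasurableSpace Ω] {μ : Measure Ω} {l : ℝ≥0} {Φ : Ω → Config}

theorem IsPoissonPointProcess.lintegral_count (h : IsPoissonPointProcess μ l Φ) {B : Set Plane}
    (hB : MeasurableSet B) (hB' : volume B ≠ ∞) :
    ∫⁻ ω, (((Φ ω).count B : ℕ∞) : ℝ≥0∞) ∂μ = l * volume B := by
  rw [(h.law_count B hB hB').lintegral_comp (f := fun n : ℕ∞ => (n : ℝ≥0∞)) (.of_discrete),
    lintegral_map .of_discrete .of_discrete]
  simp only [ENat.toENNReal_coe]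
  rw [lintegral_poissonMeasure_id, ENNReal.coe_mul, ENNReal.coe_toNNReal hB']

theorem IsPoissonPointProcess.measure_void (h : IsPoissonPointProcess μ l Φ) {B : Set Plane}
    (hB : MeasurableSet B) (hB' : volume B ≠ ∞) :
    μ {ω | (Φ ω).count B = 0} = ENNReal.ofReal (Real.exp (-(l * volume.real B))) := by
  rw [(h.law_count B hB hB').measure_eq (p := fun n => n = 0) (.of_discrete),
    Measure.map_apply .of_discrete .of_discrete]
  have : (fun n : ℕ => (n : ℕ∞)) ⁻¹' {n | n = 0} = {0} := by ext; simp
  rw [this, poissonMeasure_singleton]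
  simp [measureReal_def, ENNReal.coe_toNNReal_eq_toReal]

theorem IsPoissonPointProcess.iIndepFun_count (h : IsPoissonPointProcess μ l Φ) {κ : Type*}
    [Fintype κ] {B : κ → Set Plane} (hB : ∀ i, MeasurableSet (B i))
    (hd : ∀ i j, i ≠ j → Disjoint (B i) (B j)) : iIndepFun (fun i ω => (Φ ω).count (B i)) μ := by
  have := h.indep_count _ (B ∘ (Fintype.equivFin κ).symm) (fun _ => hB _)
    (fun i j hij => hd _ _ (by simpa using hij))
  exact (iIndepFun_precomp_of_bijective (Fintype.equivFin κ).symm.bijective).1 this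

/-- The region depends on `Φ₁` only through a finite set with finitely many possible values.
Splitting over these values replaces conditioning on `Φ₁` by independence of `Φ₁` and `Φ₂` for each
fixed region. -/
theorem lintegral_mul_void {l₂ : ℝ≥0} {Φ₁ Φ₂ : Ω → Config} {ι : Type*} [DecidableEq ι]
    (hΦ₁ : Measurable Φ₁) (hΦ₂ : IsPoissonPointProcess μ l₂ Φ₂) (hind : IndepFun Φ₁ Φ₂ μ)
    {F : Config → ℝ≥0∞} (hF : Measurable F) (N : Finset ι) {S : Config → Finset ι}
    (hSN : ∀ φ, S φ ⊆ N) (hS : ∀ T, MeasurableSet {φ | S φ = T}) {K : Finset ι → Set Plane}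
    (hK : ∀ T, MeasurableSet (K T)) (hK' : ∀ T, volume (K T) ≠ ∞) :
    ∫⁻ ω, F (Φ₁ ω) * (if (Φ₂ ω).count (K (S (Φ₁ ω))) = 0 then 1 else 0) ∂μ =
      ∫⁻ ω, F (Φ₁ ω) * ENNReal.ofReal (Real.exp (-(l₂ * volume.real (K (S (Φ₁ ω)))))) ∂μ := by
  have hsplit : ∀ (φ : Config) (v : Finset ι → ℝ≥0∞),
      F φ * v (S φ) = ∑ T ∈ N.powerset, {φ | S φ = T}.indicator F φ * v T := by
    intro φ v
    rw [Finset.sum_eq_single_of_mem (S φ) (Finset.mem_powerset.2 (hSN φ))]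
    · have hT' : φ ∈ {φ' | S φ' = S φ} := rfl
      rw [Set.indicator_of_mem hT']
    · intro T _ hT
      have hT' : φ ∉ {φ | S φ = T} := fun h => hT (Eq.symm h)
      rw [Set.indicator_of_notMem hT', zero_mul]
  have hcount : ∀ T, Measurable fun φ : Config => if φ.count (K T) = 0 then (1 : ℝ≥0∞) else 0 :=
    fun T => (Measurable.of_discrete (f := fun n : ℕ∞ => if n = 0 then (1 : ℝ≥0∞) else 0)).comp
      (measurable_count (hK T))
  have hFT : ∀ T, Measurable ({φ | S φ = T}.indicator F) := fun T => hF.indicator (hS T)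
  calc _ = ∑ T ∈ N.powerset, ∫⁻ ω, {φ | S φ = T}.indicator F (Φ₁ ω) *
        (if (Φ₂ ω).count (K T) = 0 then 1 else 0) ∂μ := by
        refine Eq.trans ?_ (lintegral_finsetSum _ fun T _ =>
          ((hFT T).comp hΦ₁).mul ((hcount T).comp hΦ₂.measurable))
        refine lintegral_congr fun ω => ?_
        exact hsplit (Φ₁ ω) fun T => if (Φ₂ ω).count (K T) = 0 then 1 else 0
    _ = ∑ T ∈ N.powerset, ∫⁻ ω, {φ | S φ = T}.indicator F (Φ₁ ω) *
        ENNReal.ofReal (Real.exp (-(l₂ * volume.real (K T)))) ∂μ := by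
        refine Finset.sum_congr rfl fun T _ => ?_
        have := lintegral_mul_eq_lintegral_mul_lintegral_of_indepFun ((hFT T).comp hΦ₁)
          ((hcount T).comp hΦ₂.measurable) (hind.comp (hFT T) (hcount T))
        simp only [Pi.mul_apply, Function.comp_apply] at this
        refine this.trans (Eq.trans ?_ (lintegral_mul_const _ ((hFT T).comp hΦ₁)).symm)
        congr 1
        rw [← hΦ₂.measure_void (hK T) (hK' T)]
        rw [← lintegral_indicator_one]
        · refine lintegral_congr fun ω => ?_
          simp [Set.indicator_apply]
        · exact ((measurable_count (hK T)).comp hΦ₂.measurable) (measurableSet_singleton 0)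
    _ = _ := by
        refine (lintegral_finsetSum _ fun T _ =>
          ((hFT T).comp hΦ₁).mul measurable_const).symm.trans ?_
        refine lintegral_congr fun ω => ?_
        exact (hsplit (Φ₁ ω) fun T =>
          ENNReal.ofReal (Real.exp (-(l₂ * volume.real (K T))))).symm

end Poisson

/-! ### Tilings and the discretized holes. -/

/-- A countable Borel partition of the plane into cells of radius less than `δ`, with locally
finitely many centers. -/
structure Tiling (ι : Type*) (δ : ℝ) where
  /-- the cells -/
  cell : ι → Set Plane
  /-- the cell centers -/
  center : ι → Plane
  measurableSet_cell : ∀ k, MeasurableSet (cell k)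
  disjoint_cell : ∀ i j, i ≠ j → Disjoint (cell i) (cell j)
  exists_mem_cell : ∀ x, ∃ k, x ∈ cell k
  dist_center_lt : ∀ k, ∀ x ∈ cell k, dist x (center k) < δ
  finite_near : ∀ p R, {k | dist (center k) p < R}.Finite

/-- The tiling of the plane by half-open squares of side `δ / 2`. -/
noncomputable def squareTiling {δ : ℝ} (hδ : 0 < δ) : Tiling (Fin 2 → ℤ) δ where
  cell k := {x | ∀ i, ⌊x i / (δ / 2)⌋ = k i}
  -- This is the lower corner of the square; side `δ / 2` keeps every point of the cell within `δ /
  -- √2 < δ` of it.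
  center k := WithLp.toLp 2 fun i => δ / 2 * k i
  measurableSet_cell k := by
    simp only [Set.ofPred_forall]
    refine MeasurableSet.iInter fun i => ?_
    have : Measurable fun x : Plane => ⌊x i / (δ / 2)⌋ := by fun_prop
    exact this (measurableSet_singleton (k i))
  disjoint_cell i j hij := by
    rw [Set.disjoint_left]
    intro x hi hj
    exact hij (funext fun m => (hi m).symm.trans (hj m))
  exists_mem_cell x := ⟨fun i => ⌊x i / (δ / 2)⌋, fun _ => rfl⟩
  dist_center_lt k x hx := by
    have h : ∀ i, (x i - δ / 2 * k i) ^ 2 < (δ / 2) ^ 2 := by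
      intro i
      have h1 := Int.floor_le (x i / (δ / 2))
      have h2 := Int.lt_floor_add_one (x i / (δ / 2))
      rw [hx i, le_div_iff₀ (by positivity)] at h1
      rw [hx i, div_lt_iff₀ (by positivity)] at h2
      nlinarith
    rw [EuclideanSpace.dist_eq, Real.sqrt_lt' hδ, Fin.sum_univ_two, Real.dist_eq, Real.dist_eq,
      sq_abs, sq_abs]
    have h0 := h 0
    have h1 := h 1
    simp only
    nlinarith
  finite_near p R := by
    refine (Set.finite_Icc (fun i => ⌊(p i - R) / (δ / 2)⌋) (fun i => ⌈(p i + R) / (δ / 2)⌉)).subset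
      fun k hk => ?_
    have h : ∀ i, |δ / 2 * k i - p i| < R := fun i =>
      lt_of_le_of_lt (by
        have := PiLp.norm_apply_le (WithLp.toLp 2 (fun i => δ / 2 * (k i : ℝ)) - p) i
        rw [← dist_eq_norm] at this
        exact this) hk
    refine ⟨fun i => ?_, fun i => ?_⟩
    · have := (abs_lt.1 (h i)).1
      refine Int.cast_le (R := ℝ).1 ((Int.floor_le _).trans ?_)
      rw [div_le_iff₀ (by positivity)]
      linarith
    · have := (abs_lt.1 (h i)).2
      refine Int.cast_le (R := ℝ).1 (le_trans ?_ (Int.le_ceil _))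
      rw [le_div_iff₀ (by positivity)]
      linarith

namespace Tiling

variable {ι : Type*} {δ : ℝ} (T : Tiling ι δ) (D r : ℝ) (k : ι)

/-- The cells other than `k` whose centers are near enough for their holes to matter at cell `k`. -/
noncomputable def near : Finset ι :=
  ((T.finite_near (T.center k) (r + D)).subset
    (fun _ h => h.1 : {j | dist (T.center j) (T.center k) < r + D ∧ j ≠ k} ⊆ _)).toFinset

theorem mem_near {j : ι} :
    j ∈ T.near D r k ↔ dist (T.center j) (T.center k) < r + D ∧ j ≠ k := by
  simp [near]

/-- The near cells occupied by the configuration `φ`. -/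
noncomputable def occupied (φ : Config) : Finset ι :=
  open Classical in (T.near D r k).filter fun j => φ.count (T.cell j) ≠ 0

theorem measurableSet_occupied [Countable ι] (S : Finset ι) :
    MeasurableSet {φ | T.occupied D r k φ = S} := by
  have h : ∀ j, MeasurableSet {φ : Config | φ.count (T.cell j) ≠ 0} := fun j =>
    measurable_count (T.measurableSet_cell j) (measurableSet_singleton 0).compl
  have e : {φ | T.occupied D r k φ = S} =
      ⋂ j, {φ | (j ∈ T.near D r k ∧ φ.count (T.cell j) ≠ 0) ↔ j ∈ S} := by
    ext φ
    simp [occupied, Finset.ext_iff]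
  rw [e]
  refine MeasurableSet.iInter fun j => ?_
  by_cases h1 : j ∈ T.near D r k <;> by_cases h2 : j ∈ S <;> simp [h1, h2]
  · exact measurableSet_setOfPred.1 (h j)
  · exact measurableSet_setOfPred.1 (measurable_count (T.measurableSet_cell j) (measurableSet_singleton 0))

/-- The ring around the center of cell `k`. -/
def ring : Set Plane := Metric.ball (T.center k) r \ Metric.ball (T.center k) D

/-- The ring around the center of cell `k` without the discs of radius `D'` centered at the cells
in `S`. -/
def void (D' : ℝ) (S : Finset ι) : Set Plane :=
  T.ring D r k \ ⋃ j ∈ S, Metric.ball (T.center j) D'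

theorem measurableSet_ring : MeasurableSet (T.ring D r k) :=
  measurableSet_ball.diff measurableSet_ball

theorem measurableSet_void (D' : ℝ) (S : Finset ι) : MeasurableSet (T.void D r k D' S) :=
  (T.measurableSet_ring D r k).diff (S.measurableSet_biUnion fun _ _ => measurableSet_ball)

theorem volume_ring_ne_top : volume (T.ring D r k) ≠ ∞ :=
  ((measure_mono Set.sdiff_subset).trans_lt measure_ball_lt_top).ne

theorem volume_void_ne_top (D' : ℝ) (S : Finset ι) : volume (T.void D r k D' S) ≠ ∞ :=
  ((measure_mono Set.sdiff_subset).trans_lt (T.volume_ring_ne_top D r k).lt_top).ne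

theorem volume_ring (hD : 0 ≤ D) (hr : D ≤ r) :
    volume.real (T.ring D r k) = Real.pi * (r ^ 2 - D ^ 2) := by
  have h : ∀ s : ℝ, 0 ≤ s → volume.real (Metric.ball (T.center k) s) = Real.pi * s ^ 2 := by
    intro s hs
    simp [measureReal_def, EuclideanSpace.volume_ball_fin_two, Real.pi_nonneg, hs, mul_comm]
  rw [ring, measureReal_sdiff (Metric.ball_subset_ball hr) measurableSet_ball
    (measure_ball_lt_top.ne), h _ hD, h _ (hD.trans hr)]
  ring

/-- The growth factor, minus one, which an occupied cell `j` contributes to the void probability at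
cell `k`. -/
noncomputable def gain (l : ℝ≥0) (D' : ℝ) (j : ι) : ℝ≥0∞ :=
  ENNReal.ofReal
    (Real.exp (l * volume.real (Metric.ball (T.center j) D' ∩ T.ring D r k)) - 1)

/-- The slack `D' + δ ≤ D` puts the disc of radius `D'` around the cell center inside the disc of
radius `D` around any point `y` of the cell. Hence the sum of cell volumes times gains is bounded by
the integral of the excess. -/
theorem gain_le_excess (l : ℝ≥0) (hD : 0 < D) (hr : D < r) {D' : ℝ} (hD' : D' + δ ≤ D) {j : ι}
    {y : Plane} (hy : y ∈ T.cell j) :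
    T.gain D r k l D' j ≤ excess l D r (y - T.center k) := by
  have hsub : Metric.ball (T.center j) D' ∩ T.ring D r k ⊆
      (fun x => x - T.center k) ⁻¹' (Metric.ball (y - T.center k) D ∩
        (Metric.ball 0 r \ Metric.ball 0 D)) := by
    rintro x ⟨h1, h2, h3⟩
    simp only [Metric.mem_ball] at h1 h2 h3
    simp only [Set.mem_preimage, Set.mem_inter_iff, Set.mem_sdiff, Metric.mem_ball,
      dist_sub_right, dist_zero_right, ← dist_eq_norm]
    refine ⟨?_, h2, h3⟩
    have := T.dist_center_lt j y hy
    have := dist_triangle_right x y (T.center j)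
    linarith
  have hvol : volume (Metric.ball (T.center j) D' ∩ T.ring D r k) ≤
      if ‖y - T.center k‖ < r + D then ENNReal.ofReal (H₂ D r ‖y - T.center k‖) else 0 := by
    refine (measure_mono hsub).trans ?_
    rw [(measurePreserving_sub_right volume (T.center k)).measure_preimage
      (measurableSet_ball.inter (measurableSet_ball.diff measurableSet_ball)).nullMeasurableSet]
    exact volume_lens_le hD hr _
  unfold gain excess
  apply ENNReal.ofReal_le_ofReal
  rw [Set.indicator_apply]
  split_ifs at hvol ⊢ with h h' h'
  · have := ENNReal.toReal_mono ENNReal.ofReal_ne_top hvol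
    rw [ENNReal.toReal_ofReal (H₂_nonneg hD hr (norm_nonneg _) h.le)] at this
    rw [measureReal_def]
    gcongr
  · exact absurd h h'
  · exact absurd h' h
  · have : volume (Metric.ball (T.center j) D' ∩ T.ring D r k) = 0 := le_antisymm hvol zero_le
    simp [measureReal_def, this]

theorem sum_volume_mul_gain_le (l : ℝ≥0) (hD : 0 < D) (hr : D < r) {D' : ℝ} (hD' : D' + δ ≤ D)
    (N : Finset ι) :
    ∑ j ∈ N, volume (T.cell j) * T.gain D r k l D' j ≤
      ENNReal.ofReal (-(2 * Real.pi * G₄ l D r)) := by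
  calc _ ≤ ∑ j ∈ N, ∫⁻ y in T.cell j, excess l D r (y - T.center k) := by
        refine Finset.sum_le_sum fun j _ => ?_
        rw [mul_comm, ← setLIntegral_const]
        exact setLIntegral_mono' (T.measurableSet_cell j) fun y hy =>
          T.gain_le_excess D r k l hD hr hD' hy
    _ = ∫⁻ y in ⋃ j ∈ N, T.cell j, excess l D r (y - T.center k) := by
        rw [lintegral_biUnion_finset (fun i _ j _ hij => T.disjoint_cell i j hij)
          fun j _ => T.measurableSet_cell j]
    _ ≤ ∫⁻ y, excess l D r (y - T.center k) := setLIntegral_le_lintegral _ _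
    _ = _ := by
        rw [lintegral_sub_right_eq_self (excess l D r), lintegral_excess l hD hr]

/-- The union bound gives one factor `exp (l * a j)` per occupied cell. As an occupied cell has
count at least `1`, that factor is at most `1 + count * gain`; empty cells contribute `1`. Factors
affine in the counts have expectations that need only the mean counts. -/
theorem exp_void_le (l : ℝ≥0) (D' : ℝ) (φ : Config) :
    ENNReal.ofReal (Real.exp (-(l * volume.real (T.void D r k D' (T.occupied D r k φ))))) ≤
      ENNReal.ofReal (Real.exp (-(l * volume.real (T.ring D r k)))) *
        ∏ j ∈ T.near D r k, (1 + (φ.count (T.cell j) : ℝ≥0∞) * T.gain D r k l D' j) := by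
  set S := T.occupied D r k φ with hS
  set a : ι → ℝ := fun j => volume.real (Metric.ball (T.center j) D' ∩ T.ring D r k) with ha
  have h1 : volume.real (T.ring D r k) ≤ volume.real (T.void D r k D' S) + ∑ j ∈ S, a j := by
    have hsub : T.ring D r k ⊆ T.void D r k D' S ∪
        ⋃ j ∈ S, (Metric.ball (T.center j) D' ∩ T.ring D r k) := by
      intro x hx
      by_cases h : x ∈ ⋃ j ∈ S, Metric.ball (T.center j) D'
      · right
        simp only [Set.mem_iUnion] at h ⊢
        obtain ⟨j, hj, hxj⟩ := h
        exact ⟨j, hj, hxj, hx⟩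
      · exact Or.inl ⟨hx, h⟩
    have hfin : ∀ j, volume (Metric.ball (T.center j) D' ∩ T.ring D r k) ≠ ∞ := fun j =>
      ((measure_mono Set.inter_subset_right).trans_lt (T.volume_ring_ne_top D r k).lt_top).ne
    have hfin' : volume (⋃ j ∈ S, (Metric.ball (T.center j) D' ∩ T.ring D r k)) ≠ ∞ :=
      ((measure_mono (Set.iUnion₂_subset fun _ _ => Set.inter_subset_right)).trans_lt
        (T.volume_ring_ne_top D r k).lt_top).ne
    calc _ ≤ volume.real (T.void D r k D' S ∪
          ⋃ j ∈ S, (Metric.ball (T.center j) D' ∩ T.ring D r k)) :=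
          measureReal_mono hsub (measure_union_ne_top (T.volume_void_ne_top D r k D' S) hfin')
      _ ≤ _ := measureReal_union_le _ _
      _ ≤ _ := by gcongr; exact measureReal_biUnion_finset_le _ _
  have h2 : Real.exp (-(l * volume.real (T.void D r k D' S))) ≤
      Real.exp (-(l * volume.real (T.ring D r k))) * ∏ j ∈ S, Real.exp (l * a j) := by
    rw [← Real.exp_sum, ← Real.exp_add, ← Finset.mul_sum]
    apply Real.exp_le_exp.2
    have := mul_le_mul_of_nonneg_left h1 l.coe_nonneg
    linarith
  refine (ENNReal.ofReal_le_ofReal h2).trans ?_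
  rw [ENNReal.ofReal_mul (Real.exp_pos _).le,
    ENNReal.ofReal_prod_of_nonneg fun _ _ => (Real.exp_pos _).le]
  gcongr
  refine (Finset.prod_le_prod' fun j hj => ?_).trans
    (Finset.prod_le_prod_of_subset_of_one_le' (s := S) (Finset.filter_subset _ _)
      fun j _ _ => le_self_add)
  have hj : φ.count (T.cell j) ≠ 0 := by
    classical
    exact (Finset.mem_filter.1 hj).2
  have hx : (0 : ℝ) ≤ l * a j := by positivity
  have he : Real.exp (l * a j) = 1 + (Real.exp (l * a j) - 1) := by ring
  rw [he, ENNReal.ofReal_add zero_le_one (by linarith [Real.one_le_exp hx]), ENNReal.ofReal_one]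
  gcongr
  have : (1 : ℝ≥0∞) ≤ (φ.count (T.cell j) : ℝ≥0∞) := by
    rw [← ENat.toENNReal_one, ENat.toENNReal_le]
    exact Order.one_le_iff_ne_zero.2 hj
  calc _ = 1 * T.gain D r k l D' j := by rw [one_mul]; rfl
    _ ≤ _ := by gcongr

end Tiling

/-! ### Averaging over the hole centers. -/

theorem G₄_nonpos (l : ℝ≥0) {D r : ℝ} (hD : 0 < D) (hr : D < r) : G₄ l D r ≤ 0 := by
  rw [G₄, ← neg_nonneg, ← intervalIntegral.integral_neg]
  refine intervalIntegral.integral_nonneg (by linarith) fun t ht => ?_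
  have := H₂_nonneg hD hr ht.1 ht.2
  have h : (0 : ℝ) ≤ l * H₂ D r t := by positivity
  rw [← neg_mul]
  exact mul_nonneg (by linarith [Real.one_le_exp h]) ht.1

theorem prod_one_add_le_exp {ι : Type*} (N : Finset ι) (u : ι → ℝ≥0∞) {c : ℝ} (hc : 0 ≤ c)
    (hu : ∑ j ∈ N, u j ≤ ENNReal.ofReal c) :
    ∏ j ∈ N, (1 + u j) ≤ ENNReal.ofReal (Real.exp c) := by
  have hfin : ∀ j ∈ N, u j ≠ ∞ := fun j hj =>
    (((Finset.single_le_sum (fun _ _ => zero_le) hj).trans hu).trans_lt ENNReal.ofReal_lt_top).ne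
  have hsum : ∑ j ∈ N, (u j).toReal ≤ c := by
    rw [← ENNReal.toReal_sum hfin]
    exact ENNReal.toReal_le_of_le_ofReal hc hu
  calc _ ≤ ∏ j ∈ N, ENNReal.ofReal (Real.exp (u j).toReal) := by
        refine Finset.prod_le_prod' fun j hj => ?_
        conv_lhs => rw [← ENNReal.ofReal_toReal (hfin j hj), ← ENNReal.ofReal_one,
          ← ENNReal.ofReal_add zero_le_one ENNReal.toReal_nonneg]
        apply ENNReal.ofReal_le_ofReal
        linarith [Real.add_one_le_exp (u j).toReal]
    _ = ENNReal.ofReal (Real.exp (∑ j ∈ N, (u j).toReal)) := by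
        rw [Real.exp_sum, ENNReal.ofReal_prod_of_nonneg fun _ _ => (Real.exp_pos _).le]
    _ ≤ _ := by gcongr

/-- The bound on the complementary contact distribution function. -/
noncomputable def tailBound (l₁ l₂ : ℝ≥0) (D r : ℝ) : ℝ :=
  Real.exp (-(l₂ * Real.pi * (r ^ 2 - D ^ 2))) * Real.exp (-(2 * Real.pi * l₁ * G₄ l₂ D r))

namespace Tiling

variable {Ω : Type*} [MeasurableSpace Ω] {μ : Measure Ω} {l₁ l₂ : ℝ≥0} {Φ₁ Φ₂ : Ω → Config}
  {ι : Type*} {δ : ℝ} (T : Tiling ι δ)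

theorem volume_cell_ne_top (k : ι) : volume (T.cell k) ≠ ∞ :=
  ((measure_mono fun x hx => Metric.mem_ball.2 (T.dist_center_lt k x hx)).trans_lt
    (measure_ball_lt_top (x := T.center k) (r := δ))).ne

/-- Since `k ∉ N`, the set `B` and the cells of `N` are pairwise disjoint, so their counts are
independent. This plays the role of the reduced Palm law and the generating functional of `Φ₁`. -/
theorem lintegral_count_mul_prod (hΦ₁ : IsPoissonPointProcess μ l₁ Φ₁) {k : ι} {B : Set Plane}
    (hB : MeasurableSet B) (hBk : B ⊆ T.cell k) (N : Finset ι) (hN : k ∉ N) {q : ι → ℝ≥0∞} :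
    ∫⁻ ω, ((Φ₁ ω).count B : ℝ≥0∞) * ∏ j ∈ N, (1 + ((Φ₁ ω).count (T.cell j) : ℝ≥0∞) * q j) ∂μ =
      l₁ * volume B * ∏ j ∈ N, (1 + l₁ * volume (T.cell j) * q j) := by
  have hBfin : volume B ≠ ∞ :=
    ((measure_mono hBk).trans_lt (T.volume_cell_ne_top k).lt_top).ne
  -- `none` stands for `B`, so that one independent family covers the weight and all the factors.
  let C : Option N → Set Plane := fun o => o.elim B fun j => T.cell j
  let g : Option N → ℕ∞ → ℝ≥0∞ := fun o n => o.elim (n : ℝ≥0∞) fun j => 1 + (n : ℝ≥0∞) * q j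
  have hC : ∀ o, MeasurableSet (C o) := by
    rintro (_ | j)
    exacts [hB, T.measurableSet_cell j]
  have hd : ∀ o o', o ≠ o' → Disjoint (C o) (C o') := by
    have hk : ∀ j : N, Disjoint B (T.cell j) := fun j =>
      (T.disjoint_cell k j fun h => hN (h ▸ j.2)).mono_left hBk
    rintro (_ | i) (_ | j) h
    · exact absurd rfl h
    · exact hk j
    · exact (hk i).symm
    · exact T.disjoint_cell i j fun h' => h (by rw [Subtype.ext h'])
  have hind := (hΦ₁.iIndepFun_count hC hd).comp g fun o => .of_discrete
  have hprob : IsProbabilityMeasure μ := hind.isProbabilityMeasure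
  have hm : ∀ o, Measurable (fun ω => g o ((Φ₁ ω).count (C o))) := fun o =>
    Measurable.comp (g := g o) .of_discrete ((measurable_count (hC o)).comp hΦ₁.measurable)
  have h := lintegral_prod_eq_prod_lintegral_of_indepFun Finset.univ _ hind hm
  simp only [Fintype.prod_option, Function.comp_apply] at h
  have h1 : ∀ ω, ∏ j : N, g (some j) ((Φ₁ ω).count (C (some j))) =
      ∏ j ∈ N, (1 + ((Φ₁ ω).count (T.cell j) : ℝ≥0∞) * q j) := fun ω =>
    Finset.prod_coe_sort N fun j => 1 + ((Φ₁ ω).count (T.cell j) : ℝ≥0∞) * q j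
  have h2 : ∀ j : ι, ∫⁻ ω, (1 + ((Φ₁ ω).count (T.cell j) : ℝ≥0∞) * q j) ∂μ =
      1 + l₁ * volume (T.cell j) * q j := by
    intro j
    have hmj : Measurable fun ω => (((Φ₁ ω).count (T.cell j) : ℕ∞) : ℝ≥0∞) :=
      Measurable.comp .of_discrete
        ((measurable_count (T.measurableSet_cell j)).comp hΦ₁.measurable)
    rw [lintegral_add_left measurable_const, lintegral_mul_const _ hmj,
      hΦ₁.lintegral_count (T.measurableSet_cell j) (T.volume_cell_ne_top j)]
    simp
  simp_rw [h1] at h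
  refine h.trans ?_
  rw [← Finset.prod_coe_sort N fun j => 1 + l₁ * volume (T.cell j) * q j]
  congr 1
  · exact hΦ₁.lintegral_count hB hBfin
  · exact Finset.prod_congr rfl fun j _ => h2 j

theorem lintegral_count_mul_void_le [Countable ι] (hΦ₁ : IsPoissonPointProcess μ l₁ Φ₁)
    (hΦ₂ : IsPoissonPointProcess μ l₂ Φ₂) (hind : IndepFun Φ₁ Φ₂ μ) {D r : ℝ} (hD : 0 < D)
    (hr : D < r) {D' : ℝ} (hD' : D' + δ ≤ D) {k : ι} {B : Set Plane} (hB : MeasurableSet B)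
    (hBk : B ⊆ T.cell k) :
    ∫⁻ ω, ((Φ₁ ω).count B : ℝ≥0∞) *
        (if (Φ₂ ω).count (T.void D r k D' (T.occupied D r k (Φ₁ ω))) = 0 then 1 else 0) ∂μ ≤
      l₁ * volume B * ENNReal.ofReal (tailBound l₁ l₂ D r) := by
  classical
  rw [lintegral_mul_void (F := fun φ => ((φ.count B : ℕ∞) : ℝ≥0∞)) hΦ₁.measurable hΦ₂ hind
    (Measurable.comp .of_discrete (measurable_count hB)) (T.near D r k)
    (S := T.occupied D r k) (fun φ => Finset.filter_subset _ _)
    (T.measurableSet_occupied D r k)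
    (T.measurableSet_void D r k D') (T.volume_void_ne_top D r k D')]
  have hk : k ∉ T.near D r k := fun h => ((T.mem_near D r k).1 h).2 rfl
  calc _ ≤ ∫⁻ ω, ENNReal.ofReal (Real.exp (-(l₂ * volume.real (T.ring D r k)))) *
        (((Φ₁ ω).count B : ℝ≥0∞) * ∏ j ∈ T.near D r k,
          (1 + ((Φ₁ ω).count (T.cell j) : ℝ≥0∞) * T.gain D r k l₂ D' j)) ∂μ := by
        refine lintegral_mono fun ω => ?_
        rw [mul_left_comm]
        gcongr
        exact T.exp_void_le D r k l₂ D' (Φ₁ ω)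
    _ = ENNReal.ofReal (Real.exp (-(l₂ * volume.real (T.ring D r k)))) * (l₁ * volume B *
        ∏ j ∈ T.near D r k, (1 + l₁ * volume (T.cell j) * T.gain D r k l₂ D' j)) := by
        rw [lintegral_const_mul' _ _ ENNReal.ofReal_ne_top,
          T.lintegral_count_mul_prod hΦ₁ hB hBk _ hk]
    _ ≤ ENNReal.ofReal (Real.exp (-(l₂ * volume.real (T.ring D r k)))) * (l₁ * volume B *
        ENNReal.ofReal (Real.exp (-(2 * Real.pi * l₁ * G₄ l₂ D r)))) := by
        gcongr
        refine prod_one_add_le_exp _ _ ?_ ?_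
        · have := G₄_nonpos l₂ hD hr
          rw [neg_nonneg]
          exact mul_nonpos_of_nonneg_of_nonpos (by positivity) this
        · simp_rw [mul_assoc (l₁ : ℝ≥0∞)]
          rw [← Finset.mul_sum]
          refine (mul_le_mul_right (T.sum_volume_mul_gain_le D r k l₂ hD hr hD' _) _).trans_eq ?_
          rw [← ENNReal.ofReal_coe_nnreal, ← ENNReal.ofReal_mul l₁.coe_nonneg]
          congr 1
          ring
    _ = _ := by
        rw [T.volume_ring D r k hD.le hr.le, tailBound, ENNReal.ofReal_mul (Real.exp_pos _).le,
          mul_left_comm, mul_assoc (l₂ : ℝ)]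

theorem measurableSet_count_void [Countable ι] (hΦ₁ : Measurable Φ₁) (hΦ₂ : Measurable Φ₂)
    (D r D' : ℝ) (k : ι) :
    MeasurableSet {ω | (Φ₂ ω).count (T.void D r k D' (T.occupied D r k (Φ₁ ω))) = 0} := by
  have e : {ω | (Φ₂ ω).count (T.void D r k D' (T.occupied D r k (Φ₁ ω))) = 0} =
      ⋃ S : Finset ι, Φ₁ ⁻¹' {φ | T.occupied D r k φ = S} ∩
        Φ₂ ⁻¹' {φ | φ.count (T.void D r k D' S) = 0} := by
    ext ω
    simp
  rw [e]
  exact MeasurableSet.iUnion fun S => (hΦ₁ (T.measurableSet_occupied D r k S)).inter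
    (hΦ₂ (measurable_count (T.measurableSet_void D r k D' S) (measurableSet_singleton 0)))

/-- A point of `Φ₂` in this region is closer than `r` to `y`, so it must lie in a hole with some
center `z`. The disc of radius `D + δ` around the cell center of `z` then contains it. -/
theorem count_void_eq_zero {D r : ℝ} (hδ : 0 < δ) {φ₁ φ₂ : Config} {k : ι} {y : Plane}
    (hy : y ∈ T.cell k)
    (hfar : ¬ contactDistance (holeProcess D (φ₁.seenFrom y) (φ₂.seenFrom y)) < ENNReal.ofReal r) :
    φ₂.count (T.void (D + 2 * δ) (r - 2 * δ) k (D + δ)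
      (T.occupied (D + 2 * δ) (r - 2 * δ) k φ₁)) = 0 := by
  rw [contactDistance_lt_iff, Set.encard_pos, Set.not_nonempty_iff_eq_empty] at hfar
  rw [Config.count, Set.encard_eq_zero, Set.eq_empty_iff_forall_notMem]
  rintro x ⟨hx₂, ⟨hxr, hxD⟩, hxS⟩
  rw [Metric.mem_ball] at hxr hxD
  have hyk := T.dist_center_lt k y hy
  have hxy : ‖x - y‖ < r := by
    rw [← dist_eq_norm]
    have := dist_triangle_right x y (T.center k)
    linarith
  have hcov : ∃ z ∈ φ₁.carrier, dist x z < D := by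
    by_contra! hcon
    refine Set.eq_empty_iff_forall_notMem.1 hfar (x - y) ⟨⟨?_, ?_⟩, ?_⟩
    · change x - y + y ∈ φ₂.carrier
      rwa [sub_add_cancel]
    · simp only [Set.mem_iUnion, not_exists, Metric.mem_ball, not_lt]
      intro z hz
      have := hcon (z + y) hz
      rwa [dist_eq_norm, sub_sub, add_comm y z, ← dist_eq_norm]
    · simpa using hxy
  obtain ⟨z, hz, hxz⟩ := hcov
  obtain ⟨j, hj⟩ := T.exists_mem_cell z
  have hzj := T.dist_center_lt j z hj
  have hxj : dist x (T.center j) < D + δ := by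
    have := dist_triangle x z (T.center j)
    linarith
  -- Holes centered in cell `k` itself, including that of `y`, never reach the ring, whose inner
  -- radius is `D + 2δ`. This is why `near` may omit `k`.
  have hjk : j ≠ k := by
    rintro rfl
    exact hxD (by linarith)
  have hnear : j ∈ T.near (D + 2 * δ) (r - 2 * δ) k := by
    refine (T.mem_near _ _ _).2 ⟨?_, hjk⟩
    have := dist_triangle_left (T.center j) (T.center k) x
    linarith
  have hocc : j ∈ T.occupied (D + 2 * δ) (r - 2 * δ) k φ₁ := by
    classical
    refine Finset.mem_filter.2 ⟨hnear, ?_⟩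
    rw [Config.count, Ne, Set.encard_eq_zero]
    exact Set.Nonempty.ne_empty ⟨z, hz, hj⟩
  exact hxS (Set.mem_biUnion hocc hxj)

end Tiling

/-! ### Assembling the Palm bound over the window. -/

theorem encard_le_tsum_inter {α ι : Type*} (s : Set α) {C : ι → Set α} (hC : ∀ x, ∃ k, x ∈ C k) :
    (s.encard : ℝ≥0∞) ≤ ∑' k, ((s ∩ C k).encard : ℝ≥0∞) := by
  have hs : s = ⋃ k, s ∩ C k := by
    rw [← Set.inter_iUnion, Set.iUnion_eq_univ_iff.2 hC, Set.inter_univ]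
  calc (s.encard : ℝ≥0∞) = ((⋃ k, s ∩ C k).encard : ℝ≥0∞) := by rw [← hs]
    _ ≤ _ := by
      simp_rw [← ENNReal.tsum_set_one]
      exact ENNReal.tsum_iUnion_le_tsum (fun _ => 1) fun k => s ∩ C k

/-- The points of `Φ₁ ∩ A` that see no point of the hole process within `r` are counted cell by
cell. Their number is dominated by a measurable sum of mean at most `ℓ₁ |A|` times the tail bound,
and the remaining points make up the Palm numerator. -/
theorem one_sub_tailBound_le {Ω : Type*} [MeasurableSpace Ω] {μ : Measure Ω}
    {l₁ l₂ : ℝ≥0} (hl₁ : 0 < l₁) {D r : ℝ} (hD : 0 < D) {Φ₁ Φ₂ : Ω → Config}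
    (hΦ₁ : IsPoissonPointProcess μ l₁ Φ₁) (hΦ₂ : IsPoissonPointProcess μ l₂ Φ₂)
    (hindep : IndepFun Φ₁ Φ₂ μ) {A : Set Plane} (hA : MeasurableSet A) (hA_pos : volume A ≠ 0)
    (hA_fin : volume A ≠ ∞) {η : ℝ} (hη : 0 < η) (hr : D + η < r - η) :
    1 - tailBound l₁ l₂ (D + η) (r - η) ≤ contactCDF μ Φ₁ Φ₂ D A r := by
  obtain ⟨δ, rfl⟩ : ∃ δ, η = 2 * δ := ⟨η / 2, by ring⟩
  have hδ : 0 < δ := by linarith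
  set T := squareTiling hδ
  set b := tailBound l₁ l₂ (D + 2 * δ) (r - 2 * δ) with hb
  have hb0 : 0 ≤ b := by rw [hb, tailBound]; positivity
  set far : Ω → Set Plane := fun ω => {y | y ∈ (Φ₁ ω).carrier ∩ A ∧
    ¬ contactDistance (holeProcess D ((Φ₁ ω).seenFrom y) ((Φ₂ ω).seenFrom y)) < ENNReal.ofReal r}
  set close : Ω → Set Plane := fun ω => {y | y ∈ (Φ₁ ω).carrier ∩ A ∧
    ((Φ₁ ω).seenFrom y, (Φ₂ ω).seenFrom y) ∈
      {φ : Config × Config | contactDistance (holeProcess D φ.1 φ.2) < ENNReal.ofReal r}}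
  set h : (Fin 2 → ℤ) → Ω → ℝ≥0∞ := fun k ω => ((Φ₁ ω).count (T.cell k ∩ A) : ℝ≥0∞) *
    (if (Φ₂ ω).count (T.void (D + 2 * δ) (r - 2 * δ) k (D + δ)
      (T.occupied (D + 2 * δ) (r - 2 * δ) k (Φ₁ ω))) = 0 then 1 else 0) with hh
  have hhm : ∀ k, Measurable (h k) := fun k =>
    (Measurable.comp (g := fun n : ℕ∞ => (n : ℝ≥0∞)) .of_discrete ((measurable_count
      ((T.measurableSet_cell k).inter hA)).comp hΦ₁.measurable)).mul
    (Measurable.ite (T.measurableSet_count_void hΦ₁.measurable hΦ₂.measurable _ _ _ k)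
      measurable_const measurable_const)
  have hfar : ∀ ω, ((far ω).encard : ℝ≥0∞) ≤ ∑' k, h k ω := by
    intro ω
    refine (encard_le_tsum_inter (far ω) T.exists_mem_cell).trans
      (ENNReal.tsum_le_tsum fun k => ?_)
    rcases (far ω ∩ T.cell k).eq_empty_or_nonempty with he | ⟨y, hy, hyk⟩
    · simp [he]
    · simp only [hh, T.count_void_eq_zero hδ hyk hy.2, if_true, mul_one]
      refine ENat.toENNReal_le.2 (Set.encard_le_encard ?_)
      rintro z ⟨hz, hzk⟩
      exact ⟨hz.1.1, hzk, hz.1.2⟩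
  have hint : ∫⁻ ω, ∑' k, h k ω ∂μ ≤ l₁ * volume A * ENNReal.ofReal b := by
    rw [lintegral_tsum fun k => (hhm k).aemeasurable]
    calc _ ≤ ∑' k, l₁ * volume (T.cell k ∩ A) * ENNReal.ofReal b :=
          ENNReal.tsum_le_tsum fun k => T.lintegral_count_mul_void_le hΦ₁ hΦ₂ hindep
            (by linarith) hr (by linarith) ((T.measurableSet_cell k).inter hA)
            Set.inter_subset_left
      _ = _ := by
          rw [ENNReal.tsum_mul_right, ENNReal.tsum_mul_left, ← measure_iUnion
            (fun i j hij => (T.disjoint_cell i j hij).mono Set.inter_subset_left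
              Set.inter_subset_left) fun k => (T.measurableSet_cell k).inter hA,
            ← Set.iUnion_inter, Set.iUnion_eq_univ_iff.2 T.exists_mem_cell, Set.univ_inter]
  have hcount : ∀ ω, (((Φ₁ ω).count A : ℕ∞) : ℝ≥0∞) ≤ (close ω).encard + ∑' k, h k ω := by
    intro ω
    refine le_trans ?_ (add_le_add_right (hfar ω) _)
    rw [← ENat.toENNReal_add, ENat.toENNReal_le]
    refine (Set.encard_le_encard fun y hy => ?_).trans (Set.encard_union_le _ _)
    exact (em _).imp (fun h => ⟨hy, h⟩) fun h => ⟨hy, h⟩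
  have hmean := hΦ₁.lintegral_count hA hA_fin
  set m : ℝ≥0∞ := l₁ * volume A with hm
  have hm0 : m ≠ 0 := mul_ne_zero (by exact_mod_cast hl₁.ne') hA_pos
  have hmt : m ≠ ∞ := ENNReal.mul_ne_top ENNReal.coe_ne_top hA_fin
  have hmain : m ≤ ∫⁻ ω, ((close ω).encard : ℝ≥0∞) ∂μ + m * ENNReal.ofReal b :=
    calc m = ∫⁻ ω, (((Φ₁ ω).count A : ℕ∞) : ℝ≥0∞) ∂μ := hmean.symm
      _ ≤ ∫⁻ ω, ((close ω).encard + ∑' k, h k ω) ∂μ := lintegral_mono hcount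
      _ = ∫⁻ ω, ((close ω).encard : ℝ≥0∞) ∂μ + ∫⁻ ω, ∑' k, h k ω ∂μ :=
        lintegral_add_right _ (Measurable.tsum hhm)
      _ ≤ _ := by gcongr
  have hle : ∫⁻ ω, ((close ω).encard : ℝ≥0∞) ∂μ ≤ m := by
    rw [← hmean]
    exact lintegral_mono fun ω => ENat.toENNReal_le.2 (Set.encard_le_encard fun y hy => hy.1)
  rw [contactCDF, palmProb, hmean]
  change _ ≤ ((∫⁻ ω, ((close ω).encard : ℝ≥0∞) ∂μ) / m).toReal
  set c := ∫⁻ ω, ((close ω).encard : ℝ≥0∞) ∂μ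
  have hct : c ≠ ∞ := (hle.trans_lt hmt.lt_top).ne
  rw [ENNReal.toReal_div, le_div_iff₀ (ENNReal.toReal_pos hm0 hmt)]
  clear_value m
  have hreal := ENNReal.toReal_mono (ENNReal.add_ne_top.2
    ⟨hct, ENNReal.mul_ne_top hmt ENNReal.ofReal_ne_top⟩) hmain
  rw [ENNReal.toReal_add hct (ENNReal.mul_ne_top hmt ENNReal.ofReal_ne_top), ENNReal.toReal_mul,
    ENNReal.toReal_ofReal hb0] at hreal
  linarith

end PHP

/-! ### Removing the perturbation of the radii. -/

theorem theorem2 {Ω : Type*} [MeasurableSpace Ω] (μ : MeasureTheory.Measure Ω)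
    [MeasureTheory.IsProbabilityMeasure μ]
    (ℓ₁ ℓ₂ : ℝ≥0) (hℓ₁ : 0 < ℓ₁) (hℓ₂ : 0 < ℓ₂) (D : ℝ) (hD : 0 < D)
    (Φ₁ Φ₂ : Ω → PHP.Config)
    (hΦ₁ : PHP.IsPoissonPointProcess μ ℓ₁ Φ₁) (hΦ₂ : PHP.IsPoissonPointProcess μ ℓ₂ Φ₂)
    (hindep : ProbabilityTheory.IndepFun Φ₁ Φ₂ μ)
    (A : Set PHP.Plane) (hA : MeasurableSet A)
    (hA_pos : MeasureTheory.volume A ≠ 0) (hA_fin : MeasureTheory.volume A ≠ ∞)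
    (r : ℝ) (hr : D < r) :
    1 - Real.exp (-(ℓ₂ * Real.pi * (r ^ 2 - D ^ 2))) *
        Real.exp (-(2 * Real.pi * ℓ₁ * PHP.G₄ ℓ₂ D r)) ≤
      PHP.contactCDF μ Φ₁ Φ₂ D A r := by
  have hG := PHP.tendsto_G₄ ℓ₂ hD hr
  have hlim : Filter.Tendsto (fun η => 1 - PHP.tailBound ℓ₁ ℓ₂ (D + η) (r - η))
      (nhdsWithin 0 (Set.Ioi 0)) (nhds (1 - PHP.tailBound ℓ₁ ℓ₂ D r)) := by
    refine tendsto_const_nhds.sub (Filter.Tendsto.mul ?_ ?_)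
    · have hc : Continuous fun η : ℝ =>
          Real.exp (-(ℓ₂ * Real.pi * ((r - η) ^ 2 - (D + η) ^ 2))) := by fun_prop
      simpa using (hc.tendsto 0).mono_left nhdsWithin_le_nhds
    · exact (Real.continuous_exp.tendsto _).comp (hG.const_mul _).neg
  have hev : ∀ᶠ η in nhdsWithin (0 : ℝ) (Set.Ioi 0), D + η < r - η := by
    have : ∀ᶠ η in nhds (0 : ℝ), D + η < r - η :=
      (by fun_prop : Continuous fun η : ℝ => D + η).continuousAt.eventually_lt
        (by fun_prop : Continuous fun η : ℝ => r - η).continuousAt (by simpa using hr)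
    exact this.filter_mono nhdsWithin_le_nhds
  refine le_of_tendsto hlim ?_
  filter_upwards [self_mem_nhdsWithin, hev] with η hη hη'
  exact PHP.one_sub_tailBound_le hℓ₁ hD hΦ₁ hΦ₂ hindep hA hA_pos hA_fin hη hη'
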